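/- **Model.** An AJQ (adversarial job queueing) system consists of a finite set $S$ of servers, an adversary $\mathcal A$ and a scheduling policy $P$, and evolves in continuous time. The adversary injects jobs at times $\ge 0$. A job $K$ is a finite nonempty set of tasks; each task $k\in K$ has a server $s_k\in S$, an activation delay $d_k\ge 0$, a processing time $t_k>0$, and a set $f^K(k)$ of subsets of $K$ (its feasibility sets). A task is feasible once its job has been injected and all tasks of at least one of its feasibility sets have been completed; it is active once it has been feasible for at least $d_k$ time units. Layer $1$ of $K$ consists of the tasks $k$ with $\emptyset\in f^K(k)$; for $j>1$, a task has layer $j$ if it is feasible when all tasks of layers $1,\dots,j-1$ are completed but not when only those of layers $1,\dots,j-2$ are. $K$ is doable if every task has a layer. All injected jobs are doable, and over all injected jobs the processing times are bounded and bounded away from $0$, and the activation delays and the numbers of tasks per job are bounded. $\mathcal A$ is an $(r,b)$-adversary, with injection rate $0<r\le 1$ and burstiness $b>1$, if for every server $s$ and every time interval $I$ the total processing time of the tasks for $s$ in the jobs injected during $I$ is at most $r|I|+b$. Each server processes one active task at a time without preemption, is never idle while an active task waits at it, and chooses the next task by the policy. The policy LCT-LIS chooses, among the active tasks waiting at the server,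 one with the longest processing time, breaking ties in favour of the task whose job was injected earliest (longest in system). The system is stable if the number $Q_s(t)$ of active tasks waiting in the queue of $s$ at time $t$ is bounded uniformly in $s\in S$ and $t$, and unstable if the system can evolve according to the policy and no such evolution is stable (whatever way any remaining ties are broken). **Proposition.** There is a finite server set $S$ such that for every $r$ with $1/\sqrt2<r\le 1$ there are $b>1$ and an $(r,b)$-adversary $\mathcal A$ for which the system $(S,\text{LCT-LIS},\mathcal A)$ is unstable. -/

import Mathlib

namespace AJQ

/-- A job over the server set `S`: finitely many tasks, each with a server, an activation delay
and a processing time, together with a feasibility function that assigns to every task its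
collection of feasibility sets. -/
structure Job (S : Type) where
  len : ℕ
  len_pos : 0 < len
  server : Fin len → S
  delay : Fin len → ℝ
  delay_nonneg : ∀ i, 0 ≤ delay i
  proc : Fin len → ℝ
  proc_pos : ∀ i, 0 < proc i
  feas : Fin len → Finset (Finset (Fin len))

/-- The tasks in layers `1, …, m`: a task belongs to this set if it is feasible as soon as all
tasks in layers `1, …, m - 1` are completed. -/
def Job.layersUpTo {S : Type} (K : Job S) : ℕ → Set (Fin K.len)
  | 0 => ∅
  | m + 1 => K.layersUpTo m ∪ {i | ∃ F ∈ K.feas i, ∀ k ∈ F, k ∈ K.layersUpTo m}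

/-- Task `i` has layer `m + 1`: it is feasible once the layers `1, …, m` are completed, but not
earlier.  Layer one consists of the tasks that have the empty set as a feasibility set. -/
def Job.HasLayer {S : Type} (K : Job S) (i : Fin K.len) (m : ℕ) : Prop :=
  i ∈ K.layersUpTo (m + 1) ∧ i ∉ K.layersUpTo m

/-- A job is doable if each of its tasks can be assigned a layer. -/
def Job.Doable {S : Type} (K : Job S) : Prop :=
  ∀ i, ∃ m, K.HasLayer i m

/-- An adversary: a family of doable jobs with injection times, such that the processing times
are bounded and bounded away from zero, and the activation delays and the numbers of tasks
per job are bounded. -/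
structure Adversary (S : Type) where
  Idx : Type
  job : Idx → Job S
  time : Idx → ℝ
  time_nonneg : ∀ j, 0 ≤ time j
  doable : ∀ j, (job j).Doable
  proc_bounds : ∃ Tmin Tmax : ℝ, 0 < Tmin ∧
    ∀ j i, Tmin ≤ (job j).proc i ∧ (job j).proc i ≤ Tmax
  delay_bound : ∃ Dmax : ℝ, ∀ j i, (job j).delay i ≤ Dmax
  len_bound : ∃ L : ℕ, ∀ j, (job j).len ≤ L

namespace Adversary

variable {S : Type} (A : Adversary S)

/-- The tasks of all the injected jobs: a job together with one of its tasks. -/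
abbrev Task : Type := Σ j : A.Idx, Fin (A.job j).len

def server (x : A.Task) : S := (A.job x.1).server x.2

def delay (x : A.Task) : ℝ := (A.job x.1).delay x.2

def proc (x : A.Task) : ℝ := (A.job x.1).proc x.2

/-- The time at which the job of the task `x` was injected. -/
def injected (x : A.Task) : ℝ := A.time x.1

/-- The total load injected for the server `s` during the time interval `[u, v]`. -/
noncomputable def load (s : S) (u v : ℝ) : ENNReal :=
  ∑' x : {x : A.Task // A.server x = s ∧ u ≤ A.injected x ∧ A.injected x ≤ v},
    ENNReal.ofReal (A.proc x.1)

/-- `A` is an `(r, b)`-adversary: injection rate `r` and burstiness `b`. -/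
def IsBounded (r b : ℝ) : Prop :=
  0 < r ∧ r ≤ 1 ∧ 1 < b ∧
    ∀ (s : S) (u v : ℝ), u ≤ v → A.load s u v ≤ ENNReal.ofReal (r * (v - u) + b)

/-! In the next four definitions, `start x` is the time at which the task `x` starts to be
processed, and it is `⊤` if that never happens.  Processing is not interrupted. -/

/-- The task `x` has been completed by time `t`. -/
def Completed (start : A.Task → WithTop ℝ) (x : A.Task) (t : ℝ) : Prop :=
  start x + ((A.proc x : ℝ) : WithTop ℝ) ≤ (t : WithTop ℝ)

/-- The task `x` is feasible at time `t`: its job has been injected, and all the tasks in one of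
its feasibility sets have been completed. -/
def Feasible (start : A.Task → WithTop ℝ) (x : A.Task) (t : ℝ) : Prop :=
  A.injected x ≤ t ∧
    ∃ F ∈ (A.job x.1).feas x.2, ∀ k ∈ F, A.Completed start ⟨x.1, k⟩ t

/-- The task `x` is active at time `t`: it has been feasible for at least its activation delay.
(A task that is feasible at some time remains so.) -/
def Active (start : A.Task → WithTop ℝ) (x : A.Task) (t : ℝ) : Prop :=
  A.Feasible start x (t - A.delay x)

/-- The server `s` is processing some task at time `t`. -/
def Busy (start : A.Task → WithTop ℝ) (s : S) (t : ℝ) : Prop :=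
  ∃ x, A.server x = s ∧ start x ≤ (t : WithTop ℝ) ∧ ¬ A.Completed start x t

end Adversary

/-- A scheduling policy given by a priority relation: `P A y x` says that the task `y` has
strictly higher priority than the task `x`. -/
abbrev Policy (S : Type) : Type 1 := ∀ A : Adversary S, A.Task → A.Task → Prop

/-- The policy that gives priority to the task with longest processing time, and among tasks of
equal processing time to the one that has been in the system for the longest time. -/
def lctLis (S : Type) : Policy S := fun A y x =>
  A.proc x < A.proc y ∨ (A.proc x = A.proc y ∧ A.injected y < A.injected x)

/-- An evolution of the system `(S, P, A)`, given by the starting times of all tasks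
(`⊤` for a task that is never served). -/
structure Execution {S : Type} (P : Policy S) (A : Adversary S) where
  start : A.Task → WithTop ℝ
  /-- Only active tasks are served. -/
  active_of_start : ∀ (x : A.Task) (t : ℝ), start x = (t : WithTop ℝ) → A.Active start x t
  /-- A server processes at most one task at a time, and without preemption. -/
  no_overlap : ∀ (x y : A.Task) (t u : ℝ), x ≠ y → A.server x = A.server y →
    start x = (t : WithTop ℝ) → start y = (u : WithTop ℝ) →
    t + A.proc x ≤ u ∨ u + A.proc y ≤ t
  /-- A server with a waiting active task is not idle. -/
  work_conserving : ∀ (x : A.Task) (t : ℝ), A.Active start x t → (t : WithTop ℝ) < start x →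
    A.Busy start (A.server x) t
  /-- A task is not started while an active task of higher priority waits at the same server. -/
  priority : ∀ (x y : A.Task) (t : ℝ), A.server x = A.server y → start x = (t : WithTop ℝ) →
    A.Active start y t → (t : WithTop ℝ) < start y → ¬ P A y x

/-- The number of tasks in the queue of the server `s` at time `t`: the active tasks that have
not started to be processed. -/
noncomputable def Execution.queue {S : Type} {P : Policy S} {A : Adversary S}
    (E : Execution P A) (s : S) (t : ℝ) : ℕ∞ :=
  Set.encard {x : A.Task | A.server x = s ∧ A.Active E.start x t ∧ (t : WithTop ℝ) < E.start x}

/-- All queues are bounded, uniformly in time. -/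
def Execution.Stable {S : Type} {P : Policy S} {A : Adversary S} (E : Execution P A) : Prop :=
  ∃ M : ℕ, ∀ (s : S) (t : ℝ), E.queue s t ≤ (M : ℕ∞)

/-- The system `(S, P, A)` is unstable: it can evolve according to the policy, and, however ties
that the policy leaves open are broken, the evolution is not stable. -/
def Unstable {S : Type} (P : Policy S) (A : Adversary S) : Prop :=
  Nonempty (Execution P A) ∧ ∀ E : Execution P A, ¬ E.Stable

end AJQ

namespace AJQ

/-! ### Uniqueness of the evolution when the priority has no ties. -/

section Uniqueness

variable {S : Type} {P : Policy S} {A : Adversary S}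

/-! Two servers exchange roles from phase to phase while the queue doubles. Suppose `N = 2 ^ k`
entry tasks of length 1 wait at one server. They feed the other server with exit tasks of length 18
faster than it can serve them. Long tasks win there, so the entry tasks of the opposite direction
starve. With an injection every 27 time units, serving the `N` old jobs and the `2N` jobs arriving
meanwhile takes `18 * 3N = 27 * 2N` time units. In that time `2N` jobs of the opposite direction
pile up, and they start the next phase.

An injection brings at most one job per direction, hence load at most `1 + 18` per server, at rate
`19/27 < 1/√2`. Among even lengths `p` of the exit task, 18 is the smallest for which `(p + 1) /
(3p/2)` is below `1/√2`.

The schedule is explicit (`entryStart`, `exitStart`) and is checked to be an execution. Tasks of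
equal length at the same server have different injection times (`tandem_total`), so no ties remain.
`Execution.start_unique` then shows that every execution is this one. -/

lemma Adversary.Completed.mono_start {s s' : A.Task → WithTop ℝ} {t u : ℝ} {x : A.Task}
    (hagree : ∀ y, s y < (t : WithTop ℝ) → s' y = s y) (hut : u ≤ t)
    (h : A.Completed s x u) : A.Completed s' x u := by
  have hpos : 0 < A.proc x := (A.job x.1).proc_pos x.2
  have hx : s x < (t : WithTop ℝ) := by
    unfold Adversary.Completed at h
    cases hsx : s x with
    | top => simp [hsx] at h
    | coe a =>
      rw [hsx] at h
      norm_cast at h ⊢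
      linarith
  unfold Adversary.Completed
  rw [hagree x hx]
  exact h

/-- Processing times are positive, so activity at `t` depends only on starts strictly before `t`. -/
lemma Adversary.Active.mono_start {s s' : A.Task → WithTop ℝ} {t : ℝ} {x : A.Task}
    (hagree : ∀ y, s y < (t : WithTop ℝ) → s' y = s y)
    (h : A.Active s x t) : A.Active s' x t := by
  obtain ⟨h1, F, hF, h2⟩ := h
  have hd : 0 ≤ A.delay x := (A.job x.1).delay_nonneg x.2
  exact ⟨h1, F, hF, fun k hk => (h2 k hk).mono_start hagree (by linarith)⟩

/-- Two executions that agree before time `t` do not start to differ at time `t`. -/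
lemma Execution.not_start_lt (E E' : Execution P A)
    (htotal : ∀ x y : A.Task, x ≠ y → A.server x = A.server y → P A x y ∨ P A y x)
    {x : A.Task} {t : ℝ} (hx : E.start x = t) (hx' : (t : WithTop ℝ) < E'.start x)
    (h1 : ∀ y, E.start y < (t : WithTop ℝ) → E'.start y = E.start y)
    (h2 : ∀ y, E'.start y < (t : WithTop ℝ) → E.start y = E'.start y) : False := by
  have hxa : A.Active E'.start x t := (E.active_of_start x t hx).mono_start h1
  obtain ⟨y, hys, hyt, hyc⟩ := E'.work_conserving x t hxa hx'
  have hxy : x ≠ y := by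
    rintro rfl
    exact absurd hyt (not_le.2 hx')
  have hpx : 0 < A.proc x := (A.job x.1).proc_pos x.2
  have hpy : 0 < A.proc y := (A.job y.1).proc_pos y.2
  -- If `y` started before `t`, it is also running in `E` and overlaps `x`. Otherwise `y` starts at
  -- `t` in `E'`, both tasks are available in both executions, and one of the two choices violates
  -- the total priority.
  rcases hyt.lt_or_eq with hlt | heq
  · have hyE := h2 y hlt
    obtain ⟨a, ha⟩ := WithTop.ne_top_iff_exists.1 (ne_top_of_lt hlt)
    rw [← ha] at hlt hyE
    have hat : a < t := by exact_mod_cast hlt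
    rcases E.no_overlap x y t a hxy hys.symm hx hyE with h | h
    · linarith
    · apply hyc
      unfold Adversary.Completed
      rw [← ha]
      exact_mod_cast h
  · have hya : A.Active E.start y t := (E'.active_of_start y t heq).mono_start h2
    have hyE : (t : WithTop ℝ) < E.start y := by
      rcases lt_trichotomy (E.start y) (t : WithTop ℝ) with h | h | h
      · have := h1 y h
        rw [heq] at this
        rw [← this] at h
        exact absurd h (lt_irrefl _)
      · rcases E.no_overlap x y t t hxy hys.symm hx h with h | h <;> linarith
      · exact h
    rcases htotal x y hxy hys.symm with h | h
    · exact E'.priority y x t hys heq hxa hx' h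
    · exact E.priority x y t hys.symm hx hya hyE h

/-- If the policy leaves no ties open and only finitely many tasks are injected in bounded time,
then there is at most one execution. -/
theorem Execution.start_unique (E E' : Execution P A)
    (htotal : ∀ x y : A.Task, x ≠ y → A.server x = A.server y → P A x y ∨ P A y x)
    (hfin : ∀ t : ℝ, {x : A.Task | A.injected x ≤ t}.Finite) : E.start = E'.start := by
  by_contra hne
  obtain ⟨x₀, hx₀⟩ := Function.ne_iff.1 hne
  set m : A.Task → WithTop ℝ := fun x => min (E.start x) (E'.start x) with hm
  have hinj : ∀ (F : Execution P A) (x : A.Task) (t : ℝ), F.start x ≤ (t : WithTop ℝ) →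
      A.injected x ≤ t := by
    intro F x t h
    obtain ⟨a, ha⟩ := WithTop.ne_top_iff_exists.1 (ne_top_of_le_ne_top (WithTop.coe_ne_top) h)
    have h1 := (F.active_of_start x a ha.symm).1
    have hd : 0 ≤ A.delay x := (A.job x.1).delay_nonneg x.2
    rw [← ha] at h
    have : a ≤ t := by exact_mod_cast h
    linarith
  have hmtop : m x₀ ≠ ⊤ := by
    intro h
    obtain ⟨h1, h2⟩ := min_eq_top.1 h
    exact hx₀ (h1.trans h2.symm)
  obtain ⟨t₀, ht₀⟩ := WithTop.ne_top_iff_exists.1 hmtop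
  set D : Set A.Task := {x | E.start x ≠ E'.start x ∧ m x ≤ t₀} with hD
  have hDfin : D.Finite := by
    refine (hfin t₀).subset ?_
    rintro x ⟨-, hx⟩
    rcases min_le_iff.1 hx with h | h
    · exact hinj E x t₀ h
    · exact hinj E' x t₀ h
  -- Local finiteness provides a first time at which the executions differ.
  obtain ⟨x, ⟨hxne, hxt₀⟩, hxmin⟩ := Set.exists_min_image D m hDfin ⟨x₀, hx₀, ht₀.ge⟩
  obtain ⟨t, ht⟩ := WithTop.ne_top_iff_exists.1 (ne_top_of_le_ne_top WithTop.coe_ne_top hxt₀)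
  have hagree : ∀ y, m y < (t : WithTop ℝ) → E.start y = E'.start y := by
    intro y hy
    by_contra hyne
    rw [ht] at hy
    exact absurd (hxmin y ⟨hyne, hy.le.trans hxt₀⟩) (not_le.2 hy)
  have h1 : ∀ y, E.start y < (t : WithTop ℝ) → E'.start y = E.start y := fun y hy =>
    (hagree y (min_lt_iff.2 (Or.inl hy))).symm
  have h2 : ∀ y, E'.start y < (t : WithTop ℝ) → E.start y = E'.start y := fun y hy =>
    hagree y (min_lt_iff.2 (Or.inr hy))
  rcases lt_or_gt_of_ne hxne with h | h
  · have hx : E.start x = t := by rw [ht, hm]; exact (min_eq_left h.le).symm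
    exact E.not_start_lt E' htotal hx (hx ▸ h) h1 h2
  · have hx : E'.start x = t := by rw [ht, hm]; exact (min_eq_right h.le).symm
    exact E'.not_start_lt E (htotal) hx (hx ▸ h) h2 h1

end Uniqueness

/-! ### The adversary

The jobs are indexed by pairs `(k, i)` with `i < 3 * 2 ^ k`.  Such a job has an entry task of
length `1` at the server `k % 2`, followed by an exit task of length `18` at the other server.
All jobs `(k, i)` are served in the `k`-th phase, which starts at time `phaseStart k`; at this
time the jobs with `i < 2 ^ k` have been injected and wait at their first server. -/

/-- The beginning of the `k`-th phase. -/
def phaseStart (k : ℕ) : ℕ := 54 * (2 ^ k - 1) + k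

/-- The time of the `M`-th injection. -/
def injTime (M : ℕ) : ℕ := 27 * (M - 2) + Nat.log 2 M

/-! ### Arithmetic of the timetable. -/

lemma phaseStart_succ (k : ℕ) : phaseStart (k + 1) = phaseStart k + 1 + 54 * 2 ^ k := by
  have := Nat.one_le_two_pow (n := k)
  simp only [phaseStart, pow_succ]
  omega

lemma phaseStart_succ_le {k l : ℕ} (h : k < l) : phaseStart (k + 1) ≤ phaseStart l := by
  have hmono : Monotone phaseStart :=
    monotone_nat_of_le_succ fun n => by rw [phaseStart_succ]; omega
  exact hmono h

lemma injTime_strictMono : StrictMonoOn injTime (Set.Ici 1) := by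
  intro M hM M' hM' h
  rw [Set.mem_Ici] at hM
  have hlog : Nat.log 2 M ≤ Nat.log 2 M' := Nat.log_mono_right h.le
  unfold injTime
  rcases Nat.lt_or_ge M 2 with h2 | h2
  · have h3 : M = 1 := by omega
    have : 1 ≤ Nat.log 2 M' := Nat.log_pos (by norm_num) (by omega)
    subst h3
    simp only [Nat.log_one_right]
    omega
  · omega

lemma injTime_of_lt {k i : ℕ} (h : i < 2 ^ k) :
    injTime (2 ^ k + i) = 27 * (2 ^ k + i - 2) + k := by
  unfold injTime
  rw [(Nat.log_eq_iff (b := 2) (m := k) (n := 2 ^ k + i) (Or.inr ⟨by norm_num, by positivity⟩)).2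
    ⟨by omega, by rw [pow_succ]; omega⟩]

lemma injTime_of_ge {k i : ℕ} (h : 2 ^ k ≤ i) (h' : i < 3 * 2 ^ k) :
    injTime (2 ^ k + i) = 27 * (2 ^ k + i - 2) + (k + 1) := by
  unfold injTime
  rw [(Nat.log_eq_iff (b := 2) (m := k + 1) (n := 2 ^ k + i)
    (Or.inr ⟨by norm_num, by positivity⟩)).2
    ⟨by rw [pow_succ]; omega, by rw [pow_succ, pow_succ]; omega⟩]

/-- The time at which the entry task of the job `(k, i)` starts. -/
def entryStart (k i : ℕ) : ℕ := max (injTime (2 ^ k + i)) (phaseStart k + i)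

/-- The time at which the exit task of the job `(k, i)` starts. -/
def exitStart (k i : ℕ) : ℕ := phaseStart k + 1 + 18 * i

/-- Each job arrives early enough for its exit task to be ready at its slot, so the exit server
never runs dry during the phase. -/
lemma injTime_le_of_phase {k i : ℕ} (h : i < 3 * 2 ^ k) :
    injTime (2 ^ k + i) ≤ phaseStart k + 18 * i := by
  have := Nat.one_le_two_pow (n := k)
  unfold phaseStart
  rcases Nat.lt_or_ge i (2 ^ k) with h1 | h1
  · rw [injTime_of_lt h1]; omega
  · rw [injTime_of_ge h1 h]; omega

lemma injTime_le_phaseStart {k i : ℕ} (h : i < 2 ^ k) :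
    injTime (2 ^ k + i) ≤ phaseStart k := by
  have := Nat.one_le_two_pow (n := k)
  unfold phaseStart
  rw [injTime_of_lt h]; omega

/-- The exit server idles during the first time unit of a phase. The logarithm in `injTime` delays
the opposite jobs just enough that they cannot use this gap. -/
lemma phaseStart_lt_injTime {k i : ℕ} (h : i < 3 * 2 ^ (k + 1)) :
    phaseStart k + 1 ≤ injTime (2 ^ (k + 1) + i) := by
  have := Nat.one_le_two_pow (n := k)
  unfold phaseStart
  rcases Nat.lt_or_ge i (2 ^ (k + 1)) with h1 | h1
  · rw [injTime_of_lt h1, pow_succ]; omega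
  · rw [injTime_of_ge h1 h, pow_succ]; omega

lemma entryStart_lt_exitStart {k i : ℕ} (h : i < 3 * 2 ^ k) :
    entryStart k i + 1 ≤ exitStart k i := by
  have := injTime_le_of_phase h
  unfold entryStart exitStart
  omega

lemma exitStart_add_le {k i : ℕ} (h : i < 3 * 2 ^ k) :
    exitStart k i + 18 ≤ phaseStart (k + 1) := by
  rw [phaseStart_succ]
  unfold exitStart
  omega

lemma phaseStart_le_entryStart (k i : ℕ) : phaseStart k ≤ entryStart k i := by
  unfold entryStart
  omega

lemma entryStart_add_le {k i j : ℕ} (h : i < j) :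
    entryStart k i + 1 ≤ entryStart k j := by
  have h0 := Nat.one_le_two_pow (n := k)
  have := injTime_strictMono (a := 2 ^ k + i) (b := 2 ^ k + j) (by simp; omega)
    (by simp; omega) (by omega)
  unfold entryStart
  omega

/-- Jobs of different phases of the same parity are injected at different times. -/
lemma pow_add_lt_of_parity {k l i j : ℕ} (hp : k % 2 = l % 2) (hkl : k < l)
    (hi : i < 3 * 2 ^ k) : 2 ^ k + i < 2 ^ l + j := by
  have h2 : k + 2 ≤ l := by omega
  have h3 : 2 ^ (k + 2) ≤ 2 ^ l := Nat.pow_le_pow_right (by norm_num) h2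
  rw [pow_add] at h3
  omega

/-! ### The jobs and their activity times. -/

lemma fin_two_notMem_Iio_zero (v : Fin 2) : v ∉ Finset.Iio (0 : Fin 2) := by
  simp

lemma fin_two_mem_Iio_one (v : Fin 2) : v ∈ Finset.Iio (1 : Fin 2) ↔ v = 0 := by
  rw [Finset.mem_Iio]
  omega

/-- A job with a short entry task followed by a long exit task at the other server. -/
def tandemJob (k : ℕ) : Job (Fin 2) where
  len := 2
  len_pos := by norm_num
  server v := ⟨(k + v.val) % 2, Nat.mod_lt _ (by norm_num)⟩
  delay _ := 0
  delay_nonneg _ := le_rfl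
  proc v := if v.val = 0 then 1 else 18
  proc_pos v := by split_ifs <;> norm_num
  feas v := {Finset.Iio v}

lemma tandemJob_doable (k : ℕ) : (tandemJob k).Doable := by
  have h0 : ((0 : Fin 2) : Fin (tandemJob k).len) ∈ (tandemJob k).layersUpTo 1 :=
    Or.inr ⟨Finset.Iio (0 : Fin 2), Finset.mem_singleton_self _, fun v hv =>
      absurd hv (fin_two_notMem_Iio_zero v)⟩
  intro v
  change Fin 2 at v
  fin_cases v
  · exact ⟨0, h0, fun h => h⟩
  · refine ⟨1, Or.inr ⟨Finset.Iio (1 : Fin 2), Finset.mem_singleton_self _, fun v hv => ?_⟩, ?_⟩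
    · rw [(fin_two_mem_Iio_one v).1 hv]
      exact h0
    · rintro (h | ⟨F, hF, h⟩)
      · exact h
      · have hF' : F = Finset.Iio (1 : Fin 2) := Finset.mem_singleton.1 hF
        refine h (0 : Fin 2) ?_
        rw [hF']
        exact (fin_two_mem_Iio_one 0).2 rfl

/-- The adversary, which injects tandem jobs in both directions at rate `19 / 27`. -/
def tandemAdversary : Adversary (Fin 2) where
  Idx := {p : ℕ × ℕ // p.2 < 3 * 2 ^ p.1}
  job p := tandemJob p.1.1
  time p := injTime (2 ^ p.1.1 + p.1.2)
  time_nonneg _ := Nat.cast_nonneg _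
  doable p := tandemJob_doable p.1.1
  proc_bounds := ⟨1, 18, by norm_num, fun p v => by
    simp only [tandemJob]; split_ifs <;> norm_num⟩
  delay_bound := ⟨0, fun _ _ => le_rfl⟩
  len_bound := ⟨2, fun _ => le_rfl⟩

/-- The entry (`v = 0`) or exit (`v = 1`) task of the job `(k, i)`. -/
def tandemTask (k i : ℕ) (h : i < 3 * 2 ^ k) (v : Fin 2) : tandemAdversary.Task :=
  ⟨⟨(k, i), h⟩, v⟩

lemma tandemTask_cases {p : tandemAdversary.Task → Prop}
    (h0 : ∀ k i h, p (tandemTask k i h 0)) (h1 : ∀ k i h, p (tandemTask k i h 1)) (x) : p x := by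
  obtain ⟨⟨⟨k, i⟩, h⟩, v⟩ := x
  change Fin 2 at v
  fin_cases v
  · exact h0 k i h
  · exact h1 k i h

section Task

variable {k i : ℕ} (h : i < 3 * 2 ^ k)

lemma server_entry : tandemAdversary.server (tandemTask k i h 0) =
    ⟨k % 2, Nat.mod_lt _ (by norm_num)⟩ := rfl

lemma server_exit : tandemAdversary.server (tandemTask k i h 1) =
    ⟨(k + 1) % 2, Nat.mod_lt _ (by norm_num)⟩ := rfl

lemma proc_entry : tandemAdversary.proc (tandemTask k i h 0) = 1 := rfl

lemma proc_exit : tandemAdversary.proc (tandemTask k i h 1) = 18 := rfl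

lemma injected_task (v : Fin 2) : tandemAdversary.injected (tandemTask k i h v) =
    (injTime (2 ^ k + i) : ℝ) := rfl

/-- The starting times of the tasks. -/
def tandemStart (x : tandemAdversary.Task) : ℕ :=
  if x.2.val = 0 then entryStart x.1.1.1 x.1.1.2 else exitStart x.1.1.1 x.1.1.2

/-- The starting times of the tasks, as required in an execution. -/
def tandemStartTop (x : tandemAdversary.Task) : WithTop ℝ := ((tandemStart x : ℝ) : WithTop ℝ)

lemma tandemStart_entry : tandemStart (tandemTask k i h 0) = entryStart k i := rfl

lemma tandemStart_exit : tandemStart (tandemTask k i h 1) = exitStart k i := rfl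

lemma completed_iff (x : tandemAdversary.Task) (t : ℝ) :
    tandemAdversary.Completed tandemStartTop x t ↔ tandemStart x + tandemAdversary.proc x ≤ t := by
  unfold Adversary.Completed tandemStartTop
  norm_cast

lemma active_entry_iff (t : ℝ) : tandemAdversary.Active tandemStartTop (tandemTask k i h 0) t ↔
    (injTime (2 ^ k + i) : ℝ) ≤ t := by
  have ht : t - tandemAdversary.delay (tandemTask k i h 0) = t := sub_zero t
  unfold Adversary.Active Adversary.Feasible
  rw [ht, injected_task]
  refine ⟨And.left, fun h1 => ⟨h1, Finset.Iio (0 : Fin 2), Finset.mem_singleton_self _, ?_⟩⟩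
  intro v hv
  exact absurd hv (fin_two_notMem_Iio_zero v)

lemma active_exit_iff (t : ℝ) : tandemAdversary.Active tandemStartTop (tandemTask k i h 1) t ↔
    (entryStart k i : ℝ) + 1 ≤ t := by
  have ht : t - tandemAdversary.delay (tandemTask k i h 1) = t := sub_zero t
  have h0 : tandemAdversary.Completed tandemStartTop (tandemTask k i h 0) t ↔
      (entryStart k i : ℝ) + 1 ≤ t := completed_iff _ _
  unfold Adversary.Active Adversary.Feasible
  rw [ht, injected_task, ← h0]
  constructor
  · rintro ⟨-, F, hF, hc⟩
    have hF' : F = Finset.Iio (1 : Fin 2) := Finset.mem_singleton.1 hF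
    refine hc (0 : Fin 2) ?_
    rw [hF']
    exact (fin_two_mem_Iio_one 0).2 rfl
  · intro hc
    refine ⟨?_, Finset.Iio (1 : Fin 2), Finset.mem_singleton_self _, fun v hv => ?_⟩
    · have h1 : (injTime (2 ^ k + i) : ℝ) ≤ entryStart k i := by
        exact_mod_cast le_max_left _ _
      linarith [h0.1 hc]
    · rw [(fin_two_mem_Iio_one v).1 hv]
      exact hc

end Task

/-! ### The explicit schedule obeys the policy. -/

lemma busy_of_floor {x : tandemAdversary.Task} {s : Fin 2} {t : ℝ} {p : ℕ} (ht : 0 ≤ t)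
    (hs : tandemAdversary.server x = s) (hp : tandemAdversary.proc x = p)
    (h1 : tandemStart x ≤ ⌊t⌋₊) (h2 : ⌊t⌋₊ < tandemStart x + p) :
    tandemAdversary.Busy tandemStartTop s t := by
  refine ⟨x, hs, ?_, ?_⟩
  · unfold tandemStartTop
    exact_mod_cast (Nat.le_floor_iff ht).1 h1
  · rw [completed_iff, hp, not_le]
    exact_mod_cast (Nat.floor_lt ht).1 h2

lemma busy_exit {k : ℕ} {t : ℝ} (ht : 0 ≤ t) (h1 : phaseStart k + 1 ≤ ⌊t⌋₊)
    (h2 : ⌊t⌋₊ < phaseStart (k + 1)) :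
    tandemAdversary.Busy tandemStartTop ⟨(k + 1) % 2, Nat.mod_lt _ (by norm_num)⟩ t := by
  rw [phaseStart_succ] at h2
  -- Exit tasks run back to back in slots of length 18; this is the index of the current slot.
  have hj : (⌊t⌋₊ - phaseStart k - 1) / 18 < 3 * 2 ^ k := by omega
  refine busy_of_floor (x := tandemTask k _ hj 1) (p := 18) ht rfl
    (by rw [proc_exit]; norm_num) ?_ ?_ <;>
  · rw [tandemStart_exit, exitStart]
    omega

lemma tandem_work_conserving (x : tandemAdversary.Task) (t : ℝ)
    (ha : tandemAdversary.Active tandemStartTop x t) (hw : (t : WithTop ℝ) < tandemStartTop x) :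
    tandemAdversary.Busy tandemStartTop (tandemAdversary.server x) t := by
  have hw' : t < tandemStart x := by
    unfold tandemStartTop at hw
    exact_mod_cast hw
  revert ha hw'
  clear hw
  refine tandemTask_cases (p := fun x => tandemAdversary.Active tandemStartTop x t →
    t < tandemStart x → tandemAdversary.Busy tandemStartTop (tandemAdversary.server x) t) ?_ ?_ x
  · intro k i h ha hw
    rw [active_entry_iff] at ha
    have ht : 0 ≤ t := (Nat.cast_nonneg _).trans ha
    have ha' := (Nat.le_floor_iff ht).2 ha
    have hw' := (Nat.floor_lt ht).2 hw
    rw [tandemStart_entry] at hw'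
    -- Before phase `k` the server is occupied by exit tasks of the previous phase. Within the
    -- phase, a waiting entry `i` forces the entry of index `⌊t⌋₊ - phaseStart k` to be running.
    rcases Nat.lt_or_ge ⌊t⌋₊ (phaseStart k) with hlt | hge
    · cases k with
      | zero => simp [phaseStart] at hlt
      | succ k => exact busy_exit ht ((phaseStart_lt_injTime h).trans ha') hlt
    · have hi : ⌊t⌋₊ < phaseStart k + i := by
        unfold entryStart at hw'
        omega
      have hj : ⌊t⌋₊ - phaseStart k < 3 * 2 ^ k := by omega
      have h0 := Nat.one_le_two_pow (n := k)
      have hmono := injTime_strictMono (a := 2 ^ k + (⌊t⌋₊ - phaseStart k)) (b := 2 ^ k + i)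
        (by simp; omega) (by simp; omega) (by omega)
      refine busy_of_floor (x := tandemTask k _ hj 0) (p := 1) ht rfl
        (by rw [proc_entry]; norm_num) ?_ ?_ <;>
      · rw [tandemStart_entry, entryStart]
        omega
  · intro k i h ha hw
    rw [active_exit_iff] at ha
    have ht : 0 ≤ t := le_trans (by positivity) ha
    have ha' : entryStart k i + 1 ≤ ⌊t⌋₊ := (Nat.le_floor_iff ht).2 (by exact_mod_cast ha)
    have hw' := (Nat.floor_lt ht).2 hw
    rw [tandemStart_exit] at hw'
    have h1 := phaseStart_le_entryStart k i
    have h2 := exitStart_add_le h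
    exact busy_exit (k := k) ht (by omega) (by omega)

lemma tandem_active_of_start (x : tandemAdversary.Task) (t : ℝ)
    (h : tandemStartTop x = (t : WithTop ℝ)) : tandemAdversary.Active tandemStartTop x t := by
  have ht : (tandemStart x : ℝ) = t := by
    unfold tandemStartTop at h
    exact_mod_cast h
  subst ht
  clear h
  refine tandemTask_cases
    (p := fun x => tandemAdversary.Active tandemStartTop x (tandemStart x)) ?_ ?_ x
  · intro k i h
    rw [active_entry_iff, tandemStart_entry]
    exact_mod_cast le_max_left _ _
  · intro k i h
    rw [active_exit_iff, tandemStart_exit]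
    exact_mod_cast entryStart_lt_exitStart h

lemma entryStart_add_le_phaseStart {k i : ℕ} (h : i < 3 * 2 ^ k) :
    entryStart k i + 19 ≤ phaseStart (k + 1) := by
  have h1 := entryStart_lt_exitStart h
  have h2 := exitStart_add_le h
  omega

lemma tandem_no_overlap (x y : tandemAdversary.Task) (hxy : x ≠ y)
    (hs : tandemAdversary.server x = tandemAdversary.server y) :
    tandemStart x + tandemAdversary.proc x ≤ tandemStart y ∨
      tandemStart y + tandemAdversary.proc y ≤ tandemStart x := by
  revert hxy hs
  refine tandemTask_cases (p := fun x => x ≠ y → tandemAdversary.server x =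
    tandemAdversary.server y → tandemStart x + tandemAdversary.proc x ≤ tandemStart y ∨
      tandemStart y + tandemAdversary.proc y ≤ tandemStart x) ?_ ?_ x
  all_goals intro k i h
  all_goals refine tandemTask_cases (p := fun y => _ ≠ y → tandemAdversary.server _ =
    tandemAdversary.server y → tandemStart _ + tandemAdversary.proc _ ≤ (tandemStart y : ℝ) ∨
      tandemStart y + tandemAdversary.proc y ≤ (tandemStart _ : ℝ)) ?_ ?_ y
  all_goals
    intro l j h' hxy hs
    simp only [server_entry, server_exit, Fin.mk.injEq] at hs
    simp only [tandemStart_entry, tandemStart_exit, proc_entry, proc_exit]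
    norm_cast
    have hk := entryStart_add_le_phaseStart h
    have hl := entryStart_add_le_phaseStart h'
    have hk' := exitStart_add_le h
    have hl' := exitStart_add_le h'
    have hk0 := phaseStart_le_entryStart k i
    have hl0 := phaseStart_le_entryStart l j
    have hk1 : phaseStart k ≤ exitStart k i := by unfold exitStart; omega
    have hl1 : phaseStart l ≤ exitStart l j := by unfold exitStart; omega
    rcases lt_trichotomy k l with hkl | hkl | hkl
    · have := phaseStart_succ_le hkl
      omega
    · subst hkl
      first
      | omega
      | have hij : i ≠ j := by rintro rfl; exact hxy rfl
        rcases lt_or_gt_of_ne hij with hij | hij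
        all_goals
          first
          | have := entryStart_add_le (k := k) hij
            omega
          | unfold exitStart
            omega
    · have := phaseStart_succ_le hkl
      omega

lemma injTime_phase_lt_of_start {k l i j : ℕ} (hp : k % 2 = l % 2) (h : i < 3 * 2 ^ k)
    (hlt : injTime (2 ^ l + j) < injTime (2 ^ k + i)) : l < k ∨ (l = k ∧ j < i) := by
  have h0 := Nat.one_le_two_pow (n := k)
  have h1 := Nat.one_le_two_pow (n := l)
  have hM : 2 ^ l + j < 2 ^ k + i :=
    (injTime_strictMono.lt_iff_lt (by simp; omega) (by simp; omega)).1 hlt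
  rcases lt_trichotomy k l with hkl | hkl | hkl
  · have := pow_add_lt_of_parity (j := j) hp hkl h
    omega
  · subst hkl
    omega
  · exact Or.inl hkl

lemma tandem_priority (x y : tandemAdversary.Task)
    (hs : tandemAdversary.server x = tandemAdversary.server y)
    (hy : tandemAdversary.Active tandemStartTop y (tandemStart x))
    (hw : tandemStart x < tandemStart y) : ¬ lctLis (Fin 2) tandemAdversary y x := by
  revert hs hy hw
  refine tandemTask_cases (p := fun x => tandemAdversary.server x =
    tandemAdversary.server y → tandemAdversary.Active tandemStartTop y (tandemStart x) →
    tandemStart x < tandemStart y → ¬ lctLis (Fin 2) tandemAdversary y x) ?_ ?_ x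
  all_goals intro k i h
  all_goals refine tandemTask_cases (p := fun y => tandemAdversary.server _ =
    tandemAdversary.server y → tandemAdversary.Active tandemStartTop y (tandemStart _) →
    tandemStart _ < tandemStart y → ¬ lctLis (Fin 2) tandemAdversary y _) ?_ ?_ y
  all_goals
    intro l j h' hs hy hw hP
    simp only [server_entry, server_exit, Fin.mk.injEq] at hs
    simp only [lctLis, proc_entry, proc_exit, injected_task, lt_irrefl, true_and, false_or,
      Nat.cast_lt] at hP
    simp only [tandemStart_entry, tandemStart_exit, active_entry_iff, active_exit_iff] at hy hw
    norm_cast at hy hP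
  · rcases injTime_phase_lt_of_start hs h hP with hlk | ⟨rfl, hij⟩
    · have := phaseStart_succ_le hlk
      have := entryStart_add_le_phaseStart h'
      have := phaseStart_le_entryStart k i
      omega
    · have := entryStart_add_le (k := l) hij
      omega
  -- Sharing a server forces different phases: an exit task of an earlier phase has already started,
  -- and one of a later phase is not yet active.
  · have h1 := exitStart_add_le h'
    have h2 := entryStart_add_le_phaseStart h
    have h3 := phaseStart_le_entryStart k i
    have h4 := phaseStart_le_entryStart l j
    rcases lt_trichotomy k l with hkl | hkl | hkl
    · have := phaseStart_succ_le hkl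
      omega
    · omega
    · have := phaseStart_succ_le hkl
      omega
  · norm_num at hP
  · rcases injTime_phase_lt_of_start (by omega) h hP with hlk | ⟨rfl, hij⟩
    · have h1 := phaseStart_succ_le hlk
      have h2 := exitStart_add_le h'
      unfold exitStart at *
      omega
    · unfold exitStart at *
      omega

/-- The evolution of the system under the policy. -/
def tandemExecution : Execution (lctLis (Fin 2)) tandemAdversary where
  start := tandemStartTop
  active_of_start := tandem_active_of_start
  no_overlap x y t u hxy hs hx hy := by
    unfold tandemStartTop at hx hy
    norm_cast at hx hy
    subst hx hy
    exact tandem_no_overlap x y hxy hs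
  work_conserving := tandem_work_conserving
  priority x y t hs hx hy hw := by
    unfold tandemStartTop at hx hw
    norm_cast at hx
    subst hx
    norm_cast at hw
    exact tandem_priority x y hs hy hw

/-! ### Absence of ties, and unbounded queues. -/

lemma tandem_total (x y : tandemAdversary.Task) (hxy : x ≠ y)
    (hs : tandemAdversary.server x = tandemAdversary.server y) :
    lctLis (Fin 2) tandemAdversary x y ∨ lctLis (Fin 2) tandemAdversary y x := by
  -- The injection number together with the parity of the phase determines the job.
  have key : ∀ {k l i j : ℕ}, k % 2 = l % 2 → i < 3 * 2 ^ k → j < 3 * 2 ^ l →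
      ¬ (k = l ∧ i = j) → injTime (2 ^ k + i) ≠ injTime (2 ^ l + j) := by
    intro k l i j hp hi hj hne heq
    have h0 := Nat.one_le_two_pow (n := k)
    have h1 := Nat.one_le_two_pow (n := l)
    have hM : 2 ^ k + i = 2 ^ l + j :=
      injTime_strictMono.injOn (by simp; omega) (by simp; omega) heq
    rcases lt_trichotomy k l with hkl | hkl | hkl
    · have := pow_add_lt_of_parity (j := j) hp hkl hi
      omega
    · subst hkl
      omega
    · have := pow_add_lt_of_parity (j := i) hp.symm hkl hj
      omega
  revert hxy hs
  refine tandemTask_cases (p := fun x => x ≠ y → tandemAdversary.server x =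
    tandemAdversary.server y → lctLis (Fin 2) tandemAdversary x y ∨
      lctLis (Fin 2) tandemAdversary y x) ?_ ?_ x
  all_goals intro k i h
  all_goals refine tandemTask_cases (p := fun y => _ ≠ y → tandemAdversary.server _ =
    tandemAdversary.server y → lctLis (Fin 2) tandemAdversary _ y ∨
      lctLis (Fin 2) tandemAdversary y _) ?_ ?_ y
  all_goals
    intro l j h' hxy hs
    simp only [server_entry, server_exit, Fin.mk.injEq] at hs
    simp only [lctLis, proc_entry, proc_exit, injected_task, lt_irrefl, true_and, false_or,
      Nat.cast_lt]
  · exact lt_or_gt_of_ne (key hs h h' (by rintro ⟨rfl, rfl⟩; exact hxy rfl))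
  · norm_num
  · norm_num
  · exact lt_or_gt_of_ne (key (by omega) h h' (by rintro ⟨rfl, rfl⟩; exact hxy rfl))

lemma le_injTime (M : ℕ) : 27 * M ≤ injTime M + 54 := by
  unfold injTime
  omega

lemma tandem_locally_finite (t : ℝ) :
    {x : tandemAdversary.Task | tandemAdversary.injected x ≤ t}.Finite := by
  set n := ⌊t⌋₊ with hn
  let f : tandemAdversary.Task → ℕ × ℕ × ℕ := fun x => (x.1.1.1, x.1.1.2, x.2.val)
  have hf : Function.Injective f := by
    rintro ⟨⟨⟨k, i⟩, h⟩, v⟩ ⟨⟨⟨l, j⟩, h'⟩, w⟩ heq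
    simp only [f, Prod.mk.injEq] at heq
    obtain ⟨rfl, rfl, hvw⟩ := heq
    have : v = w := Fin.ext hvw
    rw [this]
  refine Set.Finite.of_finite_image (f := f) ?_ hf.injOn
  refine ((Set.finite_Iio (n + 3)).prod ((Set.finite_Iio (n + 3)).prod
    (Set.finite_Iio 2))).subset ?_
  rintro _ ⟨⟨⟨⟨k, i⟩, h⟩, v⟩, hx, rfl⟩
  have hx' : (injTime (2 ^ k + i) : ℝ) ≤ t := hx
  have h1 : injTime (2 ^ k + i) ≤ n := Nat.le_floor hx'
  have h2 := le_injTime (2 ^ k + i)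
  have h3 : k < 2 ^ k := Nat.lt_two_pow_self
  have h4 : v.val < 2 := v.isLt
  refine ⟨?_, ?_, h4⟩
  · simp only [f, Set.mem_Iio]
    omega
  · simp only [f, Set.mem_Iio]
    omega

lemma tandemExecution_not_stable : ¬ tandemExecution.Stable := by
  rintro ⟨Q, hQ⟩
  set k := Q + 1 with hk
  have hpow : Q + 1 < 2 ^ k := Nat.lt_two_pow_self
  have hq := hQ ⟨k % 2, Nat.mod_lt _ (by norm_num)⟩ (phaseStart k)
  have hlt : ∀ i : Fin (Q + 1), i.val + 1 < 2 ^ k := fun i => by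
    have := i.isLt
    omega
  let g : Fin (Q + 1) → tandemAdversary.Task := fun i =>
    tandemTask k (i.val + 1) (by have := hlt i; omega) 0
  have hg : Function.Injective g := by
    intro i j hij
    have h1 : (g i).1.1.2 = (g j).1.1.2 := by rw [hij]
    have h2 : i.val + 1 = j.val + 1 := h1
    exact Fin.ext (by omega)
  have hsub : Set.range g ⊆ {x : tandemAdversary.Task |
      tandemAdversary.server x = ⟨k % 2, Nat.mod_lt _ (by norm_num)⟩ ∧
      tandemAdversary.Active tandemExecution.start x (phaseStart k) ∧
      (((phaseStart k : ℕ) : ℝ) : WithTop ℝ) < tandemExecution.start x} := by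
    rintro _ ⟨i, rfl⟩
    refine ⟨rfl, ?_, ?_⟩
    · refine (active_entry_iff _ _).2 ?_
      exact_mod_cast injTime_le_phaseStart (hlt i)
    · have : phaseStart k < entryStart k (i.val + 1) := by
        unfold entryStart
        omega
      change (((phaseStart k : ℕ) : ℝ) : WithTop ℝ) <
        (((entryStart k (i.val + 1) : ℕ) : ℝ) : WithTop ℝ)
      exact_mod_cast this
  have hcard : ((Q + 1 : ℕ) : ℕ∞) ≤ (Q : ℕ∞) := by
    refine le_trans ?_ ((Set.encard_le_encard hsub).trans hq)
    rw [← Set.image_univ, hg.encard_image, Set.encard_univ]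
    simp
  have : Q + 1 ≤ Q := by exact_mod_cast hcard
  omega

theorem tandem_unstable : Unstable (lctLis (Fin 2)) tandemAdversary := by
  refine ⟨⟨tandemExecution⟩, fun E hE => tandemExecution_not_stable ?_⟩
  have hstart := E.start_unique tandemExecution tandem_total tandem_locally_finite
  obtain ⟨Q, hQ⟩ := hE
  refine ⟨Q, fun s t => ?_⟩
  have := hQ s t
  unfold Execution.queue at this ⊢
  rwa [hstart] at this

/-! ### The injection rate -/

/-- The slack 27 is needed only for `M = 1`, where `M - 2` is truncated. -/
lemma injTime_sub {M M' : ℕ} (h : M ≤ M') (hM : 1 ≤ M) :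
    27 * (M' - M) ≤ injTime M' - injTime M + 27 := by
  have hlog : Nat.log 2 M ≤ Nat.log 2 M' := Nat.log_mono_right h
  unfold injTime
  rcases Nat.lt_or_ge M 2 with h2 | h2
  · have h3 : M = 1 := by omega
    subst h3
    simp only [Nat.log_one_right]
    omega
  · omega

lemma card_injections_le {u v : ℝ} (huv : u ≤ v) (T : Finset ℕ)
    (hT : ∀ M ∈ T, 1 ≤ M ∧ u ≤ injTime M ∧ (injTime M : ℝ) ≤ v) :
    27 * (T.card : ℝ) ≤ v - u + 54 := by
  rcases T.eq_empty_or_nonempty with rfl | hne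
  · simp
    linarith
  · have hmin := hT _ (T.min'_mem hne)
    have hmax := hT _ (T.max'_mem hne)
    have hle : T.min' hne ≤ T.max' hne := T.min'_le _ (T.max'_mem hne)
    have hsub : T ⊆ Finset.Icc (T.min' hne) (T.max' hne) := fun M hM =>
      Finset.mem_Icc.2 ⟨T.min'_le _ hM, T.le_max' _ hM⟩
    have hcard := Finset.card_le_card hsub
    rw [Nat.card_Icc] at hcard
    have hmono := injTime_strictMono.monotoneOn (a := T.min' hne) (b := T.max' hne)
      hmin.1 hmax.1 hle
    have h1 := injTime_sub hle hmin.1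
    have h2 : 27 * T.card + injTime (T.min' hne) ≤ injTime (T.max' hne) + 54 := by omega
    have h3 : 27 * (T.card : ℝ) + injTime (T.min' hne) ≤ injTime (T.max' hne) + 54 := by
      exact_mod_cast h2
    linarith [hmin.2.1, hmax.2.2]

/-- The server and the kind of task fix the parity of the phase, so each injection contributes at
most one entry and one exit task to `s`. The constant is `38 = 19 * 54 / 27`. -/
lemma tandem_load_le (s : Fin 2) {u v : ℝ} (huv : u ≤ v) :
    tandemAdversary.load s u v ≤ ENNReal.ofReal (19 / 27 * (v - u) + 38) := by
  classical
  let inWindow : ℕ → Prop := fun M => 1 ≤ M ∧ u ≤ injTime M ∧ (injTime M : ℝ) ≤ v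
  let w : ℕ × Fin 2 → ENNReal := fun p =>
    if inWindow p.1 then (if p.2 = 0 then 1 else 18) else 0
  have hw_in : ∀ M, inWindow M → ∀ a, w (M, a) = if a = 0 then 1 else 18 := fun M hM a =>
    if_pos hM
  let f : {x : tandemAdversary.Task // tandemAdversary.server x = s ∧
      u ≤ tandemAdversary.injected x ∧ tandemAdversary.injected x ≤ v} → ℕ × Fin 2 :=
    fun x => (2 ^ x.1.1.1.1 + x.1.1.1.2, x.1.2)
  have hf : Function.Injective f := by
    rintro ⟨⟨⟨⟨k, i⟩, h⟩, a⟩, hs, _⟩ ⟨⟨⟨⟨l, j⟩, h'⟩, a'⟩, hs', _⟩ heq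
    have hM : 2 ^ k + i = 2 ^ l + j := congrArg Prod.fst heq
    have ha : a = a' := congrArg Prod.snd heq
    have hs1 : (k + a.val) % 2 = s.val := congrArg Fin.val hs
    have hs2 : (l + a'.val) % 2 = s.val := congrArg Fin.val hs'
    subst ha
    have hp : k % 2 = l % 2 := by omega
    have h1 : i < 3 * 2 ^ k := h
    have h2 : j < 3 * 2 ^ l := h'
    rcases lt_trichotomy k l with hkl | hkl | hkl
    · have := pow_add_lt_of_parity (j := j) hp hkl h1
      omega
    · subst hkl
      have : i = j := by omega
      subst this
      rfl
    · have := pow_add_lt_of_parity (j := i) hp.symm hkl h2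
      omega
  have hw : tandemAdversary.load s u v = ∑' x, w (f x) := by
    refine tsum_congr ?_
    rintro ⟨⟨⟨⟨k, i⟩, h⟩, a⟩, hs, hu, hv⟩
    have hin : inWindow (2 ^ k + i) := ⟨by have := Nat.one_le_two_pow (n := k); omega, hu, hv⟩
    change Fin 2 at a
    fin_cases a
    · exact ENNReal.ofReal_one.trans (hw_in _ hin 0).symm
    · exact (ENNReal.ofReal_ofNat 18).trans (hw_in _ hin 1).symm
  set T : Finset ℕ := (Finset.range (⌊v⌋₊ + 3)).filter inWindow with hTdef
  have hT : ∀ M, inWindow M → M ∈ T := by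
    intro M hM
    refine Finset.mem_filter.2 ⟨Finset.mem_range.2 ?_, hM⟩
    have h1 := Nat.le_floor hM.2.2
    have h2 := le_injTime M
    omega
  have hsum : ∑' p, w p = T.card * 19 := by
    rw [tsum_eq_sum (s := T ×ˢ Finset.univ), Finset.sum_product]
    · rw [Finset.sum_congr rfl (g := fun _ => (19 : ENNReal))]
      · simp
      · intro M hM
        have hin : inWindow M := (Finset.mem_filter.1 hM).2
        rw [Fin.sum_univ_two, hw_in M hin, hw_in M hin]
        norm_num
    · rintro ⟨M, a⟩ hp
      have hin : ¬ inWindow M := fun h =>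
        hp (Finset.mem_product.2 ⟨hT M h, Finset.mem_univ _⟩)
      simp only [w]
      rw [if_neg hin]
  have hcard := card_injections_le huv T fun M hM => (Finset.mem_filter.1 hM).2
  calc tandemAdversary.load s u v = ∑' x, w (f x) := hw
    _ ≤ ∑' p, w p := ENNReal.tsum_comp_le_tsum_of_injective hf w
    _ = T.card * 19 := hsum
    _ = ENNReal.ofReal (T.card * 19) := by
      rw [ENNReal.ofReal_mul (Nat.cast_nonneg _), ENNReal.ofReal_natCast, ENNReal.ofReal_ofNat]
    _ ≤ _ := ENNReal.ofReal_le_ofReal (by linarith)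

theorem tandem_isBounded {r : ℝ} (h : 19 / 27 ≤ r) (hr : r ≤ 1) :
    tandemAdversary.IsBounded r 38 := by
  refine ⟨by linarith, hr, by norm_num, fun s u v huv => (tandem_load_le s huv).trans ?_⟩
  refine ENNReal.ofReal_le_ofReal ?_
  have := mul_le_mul_of_nonneg_right h (sub_nonneg.2 huv)
  linarith

end AJQ

theorem mainTheorem4 :
    ∃ n : ℕ, ∀ r : ℝ, 1 / Real.sqrt 2 < r → r ≤ 1 →
      ∃ (b : ℝ) (A : AJQ.Adversary (Fin n)),
        A.IsBounded r b ∧ AJQ.Unstable (AJQ.lctLis (Fin n)) A := by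
  refine ⟨2, fun r hr hr1 => ⟨38, AJQ.tandemAdversary, AJQ.tandem_isBounded ?_ hr1,
    AJQ.tandem_unstable⟩⟩
  refine le_trans ?_ hr.le
  rw [le_div_iff₀ (by positivity)]
  -- This holds because `2 * 19 ^ 2 = 722 ≤ 729 = 27 ^ 2`.
  have h2 : Real.sqrt 2 ≤ 27 / 19 := Real.sqrt_le_iff.2 ⟨by norm_num, by norm_num⟩
  linarith
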